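/- **Setting.** An instance of multi-color probabilistic fair $k$-center consists of a finite metric space $(\mathcal C,d)$ with $n$ points, an integer $k$, a finite color set $\mathcal H$, probabilities $p_j^{h}\ge 0$ with $\sum_{h\in\mathcal H}p_j^h=1$ for every point $j$, and bounds $l_h,u_h$ for $h\in\mathcal H$. A feasible solution is a set $S'\subseteq\mathcal C$ with $|S'|\le k$ and $\phi:\mathcal C\to S'$ such that $l_h|\phi^{-1}(i)|\le\sum_{j\in\phi^{-1}(i)}p_j^h\le u_h|\phi^{-1}(i)|$ for all $i\in S'$, $h\in\mathcal H$; its cost is $\max_{j}d(j,\phi(j))$ and $\mathrm{OPT}$ is the least cost. Let $S$, $|S|\le k$, be a set of centers which, with some assignment $\mathcal C\to S$, has cost at most $\alpha\ge1$ times the least cost of a $k$-clustering without fairness constraints. An *LP solution* with cluster-size bound $L\ge 0$ consists of $T\subseteq S$ (the centers of $S$ that are used; the others are omitted), a radius $w\ge0$, and $x\in[0,1]^{T\times\mathcal C}$ with $$\sum_{i\in T}x_{ij}=1,\qquad l_h\sum_jx_{ij}\le\sum_jp^h_jx_{ij}\le u_h\sum_jx_{ij},\qquad \sum_jx_{ij}\ge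 L,\qquad x_{ij}=0\text{ if }d(i,j)>w,$$ where $w$ is the least radius for which such $T$ and $x$ exist. *Dependent rounding* (Gandhi, Khuller, Parthasarathy, Srinivasan) starts with $y=x$ on the edges of the bipartite graph between $T$ and $\mathcal C$. While some edge is floating ($0<y_e<1$), it takes a simple cycle, or a maximal path (all floating edges at the two ends belong to the path), of floating edges, and partitions its edges into two matchings $M_1,M_2$. Let $a>0$ (resp. $b>0$) be least such that raising $y$ by $a$ on $M_1$ and lowering it by $a$ on $M_2$ (resp. lowering by $b$ on $M_1$ and raising by $b$ on $M_2$) makes some edge of $M_1\cup M_2$ integral; the first change is made with probability $b/(a+b)$, the second with probability $a/(a+b)$. The final values are $X\in\{0,1\}^{T\times\mathcal C}$. The rule that picks the cycles, paths and matchings is arbitrary. **Theorem.** Let $r\in(0,1)$, $c_0>0$, $l_{\min}>0$, $\delta\in(0,1)$, $c>0$. There is an $N$ depending only on these such that the following holds for every instance with $l_h\ge l_{\min}$ for all $h$, every $L\ge 0$ such that some optimal solution has all its clusters of size at least $L$, and all $\alpha$ and $S$ as above. An LP solution exists, and for every LP solution $(T,w,x)$ dependent rounding of $x$ can be carried out,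 and every outcome law of it satisfies: 1. Almost surely there is $\phi:\mathcal C\to T$ with $X_{ij}=1$ if $\phi(j)=i$ and $X_{ij}=0$ otherwise, $|T|\le k$, and $\max_jd(j,\phi(j))\le(\alpha+2)\,\mathrm{OPT}$. 2. For each $i\in T$ and $h\in\mathcal H$, with $\mu_{ih}=\sum_jp_j^hx_{ij}$ the amount of color $h$ that the LP assigns to $i$, $$\Pr\Big[\Big|\sum_jp^h_jX_{ij}-\mu_{ih}\Big|\ge\delta\mu_{ih}\Big]\le 2e^{-\mu_{ih}\delta^2/3}.$$ If $L>0$, then $$\Pr\Big[\exists i\in T,h\in\mathcal H:\Big|\sum_jp^h_jX_{ij}-\mu_{ih}\Big|\ge\delta\mu_{ih}\Big]\le 2\,\frac nL\,|\mathcal H|\,e^{-\frac{\delta^2}{3}L\,l_{\min}},$$ and if $L\ge c_0n^r$ (large clusters) and $n\ge N$, this probability is at most $n^{-c}$. -/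

import Mathlib

open MeasureTheory

/-! ### Probabilistic fair `k`-center -/

/-- The data of probabilistic fair `k`-center on a point set `P` with color set `H`:
`p j h` is the probability that point `j` has color `h`, and `l h`, `u h` are the prescribed
lower and upper bounds on the proportion of color `h` in every cluster. -/
structure FairInstance (P H : Type*) [Fintype H] where
  k : ℕ
  p : P → H → ℝ
  p_nonneg : ∀ j h, 0 ≤ p j h
  p_sum : ∀ j, ∑ h, p j h = 1
  l : H → ℝ
  u : H → ℝ

/-- `S` is a set of at most `k` centers and `φ` assigns every point to a center in `S`. -/
def IsClustering {P : Type*} (k : ℕ) (S : Finset P) (φ : P → P) : Prop :=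
  S.card ≤ k ∧ ∀ j, φ j ∈ S

/-- The `k`-center cost `max_j d(j, φ(j))` of an assignment (`0` if there are no points). -/
noncomputable def centerCost {P : Type*} [MetricSpace P] (φ : P → P) : ℝ :=
  ⨆ j, dist j (φ j)

/-- `S` is the set of centers returned by a color-blind `α`-approximation on the given points:
together with some assignment, it costs at most `α` times any `k`-clustering. -/
def IsColorBlindApprox {P : Type*} [MetricSpace P] (k : ℕ) (α : ℝ) (S : Finset P) : Prop :=
  ∃ φ : P → P, IsClustering k S φ ∧
    ∀ (T : Finset P) (ψ : P → P), IsClustering k T ψ → centerCost φ ≤ α * centerCost ψ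

namespace FairInstance

variable {P H : Type*} [Fintype P] [DecidableEq P] [Fintype H]

/-- The cluster `φ⁻¹(i)`. -/
def cluster (φ : P → P) (i : P) : Finset P := Finset.univ.filter fun j => φ j = i

/-- The feasible solutions of probabilistic fair clustering: the expected amount of every color in
every cluster is within the bounds. -/
def IsFeasible (I : FairInstance P H) (S : Finset P) (φ : P → P) : Prop :=
  IsClustering I.k S φ ∧
    ∀ i ∈ S, ∀ h,
      I.l h * ((cluster φ i).card : ℝ) ≤ ∑ j ∈ cluster φ i, I.p j h ∧
      ∑ j ∈ cluster φ i, I.p j h ≤ I.u h * ((cluster φ i).card : ℝ)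

/-- The optimal solutions of probabilistic fair `k`-center. -/
def IsOptimal [MetricSpace P] (I : FairInstance P H) (S : Finset P) (φ : P → P) : Prop :=
  I.IsFeasible S φ ∧
    ∀ (T : Finset P) (ψ : P → P), I.IsFeasible T ψ → centerCost φ ≤ centerCost ψ

/-- The constraints of the fair assignment LP for `k`-center with opened centers `T`, guessed
radius `w` and lower bound `L` on the cluster sizes; `x i j` is the fraction of point `j` that is
assigned to center `i`. -/
structure LPFeasible [MetricSpace P] (I : FairInstance P H) (L : ℝ) (T : Finset P) (w : ℝ)
    (x : T → P → ℝ) : Prop where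
  nonneg : ∀ i j, 0 ≤ x i j
  le_one : ∀ i j, x i j ≤ 1
  sum_eq_one : ∀ j, ∑ i, x i j = 1
  lower : ∀ i h, I.l h * ∑ j, x i j ≤ ∑ j, I.p j h * x i j
  upper : ∀ i h, ∑ j, I.p j h * x i j ≤ I.u h * ∑ j, x i j
  size : ∀ i, L ≤ ∑ j, x i j
  radius : ∀ (i : T) (j : P), w < dist (i : P) j → x i j = 0

/-- `x` is an LP assignment to the centers `S` of least radius `w`. Centers of `S` that are not
used are omitted, which leaves the set `T ⊆ S` of centers; each of these has size at least `L`. -/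
def IsLPSolution [MetricSpace P] (I : FairInstance P H) (L : ℝ) (S T : Finset P) (w : ℝ)
    (x : T → P → ℝ) : Prop :=
  T ⊆ S ∧ 0 ≤ w ∧ I.LPFeasible L T w x ∧
    ∀ (T' : Finset P) (w' : ℝ) (x' : T' → P → ℝ),
      T' ⊆ S → 0 ≤ w' → I.LPFeasible L T' w' x' → w ≤ w'

end FairInstance

/-! ### Dependent rounding -/

/-- The bipartite graph of the floating edges, i.e. those whose current value is in `(0, 1)`.
Edges that are absent from a bipartite graph are given the value `0`. -/
def floatingGraph {A B : Type*} (y : A → B → ℝ) : SimpleGraph (A ⊕ B) where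
  Adj := fun s t => ∃ a b, ((s = Sum.inl a ∧ t = Sum.inr b) ∨ (s = Sum.inr b ∧ t = Sum.inl a)) ∧
    0 < y a b ∧ y a b < 1
  symm := ⟨fun _ _ ⟨a, b, h, hy⟩ => ⟨a, b, h.elim (fun q => Or.inr ⟨q.2, q.1⟩)
    (fun q => Or.inl ⟨q.2, q.1⟩), hy⟩⟩
  loopless := ⟨fun _ ⟨a, b, h, _⟩ => by
    rcases h with ⟨h1, h2⟩ | ⟨h1, h2⟩ <;> rw [h1] at h2 <;> cases h2⟩

/-- No two distinct edges in `M` share a vertex. -/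
def IsEdgeMatching {A B : Type*} (M : Finset (A × B)) : Prop :=
  ∀ e ∈ M, ∀ f ∈ M, (e.1 = f.1 ∨ e.2 = f.2) → e = f

/-- The edge set of the walk `q` is partitioned into the two matchings `M₁` and `M₂`. -/
def IsMatchingPartition {A B : Type*} {y : A → B → ℝ} {v w : A ⊕ B}
    (q : (floatingGraph y).Walk v w) (M₁ M₂ : Finset (A × B)) : Prop :=
  IsEdgeMatching M₁ ∧ IsEdgeMatching M₂ ∧ Disjoint M₁ M₂ ∧
    ∀ a b, ((a, b) ∈ M₁ ∨ (a, b) ∈ M₂) ↔ s(Sum.inl a, Sum.inr b) ∈ q.edges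

/-- `M₁` and `M₂` are the two matchings into which the edge set of a simple cycle, or of a maximal
path, of floating edges is partitioned. A path is maximal if all floating edges at its two ends
belong to it. -/
def IsAlternatingPair {A B : Type*} (y : A → B → ℝ) (M₁ M₂ : Finset (A × B)) : Prop :=
  (∃ (v : A ⊕ B) (q : (floatingGraph y).Walk v v), q.IsCycle ∧ IsMatchingPartition q M₁ M₂) ∨
  (∃ (v w : A ⊕ B) (q : (floatingGraph y).Walk v w), v ≠ w ∧ q.IsPath ∧
    (∀ z, (floatingGraph y).Adj v z → s(v, z) ∈ q.edges) ∧
    (∀ z, (floatingGraph y).Adj w z → s(w, z) ∈ q.edges) ∧ IsMatchingPartition q M₁ M₂)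

/-- Add `γ` to the values on `M₁` and subtract `γ` from those on `M₂`. -/
def shiftEdges {A B : Type*} [DecidableEq A] [DecidableEq B] (y : A → B → ℝ)
    (M₁ M₂ : Finset (A × B)) (γ : ℝ) : A → B → ℝ := fun a b =>
  if (a, b) ∈ M₁ then y a b + γ else if (a, b) ∈ M₂ then y a b - γ else y a b

/-- `DependentRounding y ν` says that `ν` is the law of the output of the dependent rounding
procedure of Gandhi, Khuller, Parthasarathy and Srinivasan started from the edge values `y`.
While there are floating edges, the procedure picks a simple cycle or a maximal path of floating
edges with its two matchings `M₁`, `M₂` (here: by an arbitrary rule). With `α`, `β` the least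
positive amounts that make some edge integral when `M₁` is raised and `M₂` lowered, respectively
`M₁` lowered and `M₂` raised, it does the former by `α` with probability `β / (α + β)` and the
latter by `β` with probability `α / (α + β)`. It stops when all values are `0` or `1`. -/
inductive DependentRounding {A B : Type*} [DecidableEq A] [DecidableEq B] :
    (A → B → ℝ) → Measure (A → B → ℝ) → Prop
  | done (y : A → B → ℝ) (hy : ∀ a b, y a b = 0 ∨ y a b = 1) :
      DependentRounding y (Measure.dirac y)
  | step (y : A → B → ℝ) (M₁ M₂ : Finset (A × B)) (α β : ℝ) (ν₁ ν₂ : Measure (A → B → ℝ))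
      (hM : IsAlternatingPair y M₁ M₂)
      (hα : IsLeast {γ : ℝ | 0 < γ ∧
        ((∃ e ∈ M₁, y e.1 e.2 + γ = 1) ∨ (∃ e ∈ M₂, y e.1 e.2 - γ = 0))} α)
      (hβ : IsLeast {γ : ℝ | 0 < γ ∧
        ((∃ e ∈ M₁, y e.1 e.2 - γ = 0) ∨ (∃ e ∈ M₂, y e.1 e.2 + γ = 1))} β)
      (h₁ : DependentRounding (shiftEdges y M₁ M₂ α) ν₁)
      (h₂ : DependentRounding (shiftEdges y M₁ M₂ (-β)) ν₂) :
      DependentRounding y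
        (ENNReal.ofReal (β / (α + β)) • ν₁ + ENNReal.ofReal (α / (α + β)) • ν₂)

/-!
Dependent rounding keeps every marginal: the two possible changes of a step average to zero.
Two further invariants carry the theorem.

* At a point the LP values add up to `1`. A vertex with an integral sum never carries exactly one
  floating edge, so it is never the end of a maximal path, and each step raises and lowers equally
  many edges there (`IsAlternatingPair.sum_shiftEdges`). Hence the integral output assigns every
  point to exactly one center, along an edge of the LP support
  (`DependentRounding.ae_exists_assignment`), and its cost is at most the LP radius. Moving the
  centers of the optimal solution to the centers of `S` is feasible for the LP at radius
  `(α + 1) * OPT` (`FairInstance.IsFeasible.exists_lpFeasible`), which bounds the least radius.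
* At a center a step raises at most one edge and lowers at most one, by the same amount. For `t` of
  constant sign, `∏ j, (1 + t j * y i j)` is therefore a concave function of the change
  (`exists_prod_shiftEdges_le`) and a supermartingale. With `t j = exp (θ * p j) - 1` it equals
  `exp (θ * ∑ j, p j * X i j)` on integral values, so the exponential moments are bounded as for
  independent roundings and the Chernoff bound follows (`DependentRounding.chernoff`).

The laws have finite support and are built inductively, so Markov's inequality for the product is
proved by induction on the law, without integrals (`DependentRounding.measureReal_mul_le`). The
remaining bounds are a union bound over at most `n / L` centers and at most `1 / lmin` colors.

That rounding can be carried out needs a cycle or maximal path whenever an edge floats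
(`SimpleGraph.exists_isCycle_or_maximal_isPath`); orienting it, the edges traversed from left to
right and those traversed from right to left are the two matchings
(`exists_isMatchingPartition`).
-/

/-! ### Cycles and maximal paths -/

namespace SimpleGraph.Walk

variable {V : Type*} {G : SimpleGraph V} {v w s z : V}

theorem exists_ne_mem_edges_of_ncard_eq_two {q : G.Walk v w}
    (h2 : (q.toSubgraph.neighborSet s).ncard = 2) (z : V) :
    ∃ z', z' ≠ z ∧ s(s, z') ∈ q.edges := by
  obtain ⟨z', hz', hne⟩ := Set.exists_ne_of_one_lt_ncard (h2 ▸ one_lt_two) z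
  refine ⟨z', hne, ?_⟩
  rwa [← mem_edges_toSubgraph, Subgraph.mem_edgeSet]

theorem IsCycle.exists_ne_mem_edges {q : G.Walk v v} (hq : q.IsCycle) (h : s(s, z) ∈ q.edges) :
    ∃ z', z' ≠ z ∧ s(s, z') ∈ q.edges :=
  exists_ne_mem_edges_of_ncard_eq_two
    (hq.ncard_neighborSet_toSubgraph_eq_two (q.fst_mem_support_of_mem_edges h)) z

theorem IsPath.exists_ne_mem_edges {q : G.Walk v w} (hq : q.IsPath) (hv : s ≠ v) (hw : s ≠ w)
    (h : s(s, z) ∈ q.edges) : ∃ z', z' ≠ z ∧ s(s, z') ∈ q.edges := by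
  obtain ⟨i, rfl, hi⟩ := mem_support_iff_exists_getVert.mp (q.fst_mem_support_of_mem_edges h)
  refine exists_ne_mem_edges_of_ncard_eq_two
    (hq.ncard_neighborSet_toSubgraph_internal_eq_two ?_ ?_) z
  · rintro rfl
    exact hv q.getVert_zero
  · refine lt_of_le_of_ne hi ?_
    rintro rfl
    exact hw q.getVert_length

end SimpleGraph.Walk

/-- In an acyclic graph a longest path is maximal: a further edge at one of its ends would either
extend it or close a cycle. -/
theorem SimpleGraph.exists_isCycle_or_maximal_isPath {V : Type*} [Finite V] (G : SimpleGraph V)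
    {a b : V} (hab : G.Adj a b) :
    (∃ (v : V) (q : G.Walk v v), q.IsCycle) ∨
    (∃ (v w : V) (q : G.Walk v w), v ≠ w ∧ q.IsPath ∧
      (∀ z, G.Adj v z → s(v, z) ∈ q.edges) ∧ (∀ z, G.Adj w z → s(w, z) ∈ q.edges)) := by
  by_cases hG : G.IsAcyclic
  · right
    have : Nonempty V := ⟨a⟩
    obtain ⟨v, w, q, hq, hmax⟩ := SimpleGraph.Walk.exists_isPath_forall_isPath_length_le_length G
    have hlen : 1 ≤ q.length := by
      simpa using hmax _ _ _ (SimpleGraph.Walk.IsPath.of_adj hab)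
    -- stated for the first vertex only, to be applied to the path and to its reverse
    have key : ∀ {v w : V} (q : G.Walk v w), q.IsPath →
        (∀ (v' w' : V) (p : G.Walk v' w'), p.IsPath → p.length ≤ q.length) →
        ∀ z, G.Adj v z → s(v, z) ∈ q.edges := by
      intro v w q hq hmax z hz
      have hzs : z ∈ q.support := by
        by_contra hzs
        have := hmax _ _ _ (hq.cons (h := hz.symm) hzs)
        simp at this
      have hzq := hG.eq_snd_of_adj_start hq hz hzs
      have hn : ¬ q.Nil := by
        intro hn
        cases hn
        simp at hzs
        exact hz.ne hzs.symm
      rw [hzq]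
      exact q.mk_start_snd_mem_edges hn
    refine ⟨v, w, q, ?_, hq, key q hq hmax, fun z hz => ?_⟩
    · rintro rfl
      have := SimpleGraph.Walk.length_eq_zero_iff.mpr (SimpleGraph.Walk.isPath_iff_nil.mp hq)
      omega
    · have := key q.reverse hq.reverse (by simpa using hmax) z hz
      simpa using this
  · left
    simpa [SimpleGraph.IsAcyclic] using hG

/-! ### Steps of dependent rounding -/

section Rounding

variable {A B : Type*}

/-- The edges of a walk that visits no vertex twice, apart from a common start and end, split into
those traversed from left to right and those traversed from right to left. -/
theorem exists_isMatchingPartition [Finite A] [Finite B] {y : A → B → ℝ} {v w : A ⊕ B}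
    (q : (floatingGraph y).Walk v w) (hq : q.IsTrail) (h₁ : q.support.dropLast.Nodup)
    (h₂ : q.support.tail.Nodup) : ∃ M₁ M₂, IsMatchingPartition q M₁ M₂ := by
  classical
  have := Fintype.ofFinite A
  have := Fintype.ofFinite B
  rw [← q.map_fst_darts] at h₁
  rw [← q.map_snd_darts] at h₂
  have hfst := List.inj_on_of_nodup_map h₁
  have hsnd := List.inj_on_of_nodup_map h₂
  have hedge := List.inj_on_of_nodup_map hq.edges_nodup
  refine ⟨Finset.univ.filter fun e => ∃ d ∈ q.darts, d.fst = Sum.inl e.1 ∧ d.snd = Sum.inr e.2,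
    Finset.univ.filter fun e => ∃ d ∈ q.darts, d.fst = Sum.inr e.2 ∧ d.snd = Sum.inl e.1,
    ?_, ?_, ?_, ?_⟩
  · rintro ⟨a, b⟩ he ⟨a', b'⟩ hf hef
    simp only [Finset.mem_filter, Finset.mem_univ, true_and] at he hf hef
    obtain ⟨d, hd, h1, h2⟩ := he
    obtain ⟨d', hd', h1', h2'⟩ := hf
    have : d = d' := by
      rcases hef with rfl | rfl
      · exact hfst hd hd' (h1.trans h1'.symm)
      · exact hsnd hd hd' (h2.trans h2'.symm)
    subst this
    simp_all
  · rintro ⟨a, b⟩ he ⟨a', b'⟩ hf hef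
    simp only [Finset.mem_filter, Finset.mem_univ, true_and] at he hf hef
    obtain ⟨d, hd, h1, h2⟩ := he
    obtain ⟨d', hd', h1', h2'⟩ := hf
    have : d = d' := by
      rcases hef with rfl | rfl
      · exact hsnd hd hd' (h2.trans h2'.symm)
      · exact hfst hd hd' (h1.trans h1'.symm)
    subst this
    simp_all
  · rw [Finset.disjoint_left]
    rintro ⟨a, b⟩ he hf
    simp only [Finset.mem_filter, Finset.mem_univ, true_and] at he hf
    obtain ⟨d, hd, h1, h2⟩ := he
    obtain ⟨d', hd', h1', h2'⟩ := hf
    have : d = d' := by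
      refine hedge hd hd' ?_
      rw [SimpleGraph.dart_edge_eq_iff]
      right
      ext <;> simp_all
    subst this
    simp_all
  · intro a b
    simp only [Finset.mem_filter, Finset.mem_univ, true_and, SimpleGraph.Walk.edges, List.mem_map,
      SimpleGraph.dart_edge_eq_mk'_iff', ← exists_or, ← and_or_left]

namespace IsAlternatingPair

variable {y : A → B → ℝ} {M₁ M₂ : Finset (A × B)}

theorem exists_walk (h : IsAlternatingPair y M₁ M₂) :
    ∃ (v w : A ⊕ B) (q : (floatingGraph y).Walk v w), IsMatchingPartition q M₁ M₂ := by
  rcases h with ⟨v, q, -, h⟩ | ⟨v, w, q, -, -, -, -, h⟩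
  exacts [⟨v, v, q, h⟩, ⟨v, w, q, h⟩]

theorem symm (h : IsAlternatingPair y M₁ M₂) : IsAlternatingPair y M₂ M₁ := by
  have key : ∀ {v w : A ⊕ B} {q : (floatingGraph y).Walk v w},
      IsMatchingPartition q M₁ M₂ → IsMatchingPartition q M₂ M₁ :=
    fun h => ⟨h.2.1, h.1, h.2.2.1.symm, fun a b => or_comm.trans (h.2.2.2 a b)⟩
  rcases h with ⟨v, q, hq, h⟩ | ⟨v, w, q, h₁, h₂, h₃, h₄, h⟩
  exacts [Or.inl ⟨v, q, hq, key h⟩, Or.inr ⟨v, w, q, h₁, h₂, h₃, h₄, key h⟩]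

theorem isEdgeMatching (h : IsAlternatingPair y M₁ M₂) : IsEdgeMatching M₁ := by
  obtain ⟨v, w, q, hq⟩ := h.exists_walk
  exact hq.1

theorem disjoint (h : IsAlternatingPair y M₁ M₂) : Disjoint M₁ M₂ := by
  obtain ⟨v, w, q, hq⟩ := h.exists_walk
  exact hq.2.2.1

theorem floating (h : IsAlternatingPair y M₁ M₂) {a : A} {b : B}
    (hab : (a, b) ∈ M₁ ∨ (a, b) ∈ M₂) : 0 < y a b ∧ y a b < 1 := by
  obtain ⟨v, w, q, hq⟩ := h.exists_walk
  obtain ⟨a', b', h, hy⟩ := q.adj_of_mem_edges ((hq.2.2.2 a b).mp hab)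
  simp_all

/-- A vertex that carries an edge of the cycle or path carries a second one, unless it is an end
of a maximal path, where that edge is the only floating one. -/
theorem exists_ne_or_unique (h : IsAlternatingPair y M₁ M₂) {a : A} {b : B}
    (hab : (a, b) ∈ M₁ ∨ (a, b) ∈ M₂) :
    (∃ a', a' ≠ a ∧ ((a', b) ∈ M₁ ∨ (a', b) ∈ M₂)) ∨
      ∀ a', a' ≠ a → ¬ (0 < y a' b ∧ y a' b < 1) := by
  have key : ∀ {v w : A ⊕ B} (q : (floatingGraph y).Walk v w), IsMatchingPartition q M₁ M₂ →
      (∃ z, z ≠ Sum.inl a ∧ s(Sum.inr b, z) ∈ q.edges) →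
      ∃ a', a' ≠ a ∧ ((a', b) ∈ M₁ ∨ (a', b) ∈ M₂) := by
    rintro v w q hq ⟨z, hz, hzq⟩
    obtain ⟨a', b', h, -⟩ := q.adj_of_mem_edges hzq
    have : z = Sum.inl a' ∧ b' = b := by aesop
    obtain ⟨rfl, rfl⟩ := this
    refine ⟨a', fun h => hz (by rw [h]), ?_⟩
    rw [hq.2.2.2 a' b', Sym2.eq_swap]
    exact hzq
  have key' : ∀ {v w : A ⊕ B} (q : (floatingGraph y).Walk v w), IsMatchingPartition q M₁ M₂ →
      (∀ z, (floatingGraph y).Adj (Sum.inr b) z → s(Sum.inr b, z) ∈ q.edges) →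
      (∃ a', a' ≠ a ∧ ((a', b) ∈ M₁ ∨ (a', b) ∈ M₂)) ∨
        ∀ a', a' ≠ a → ¬ (0 < y a' b ∧ y a' b < 1) := by
    intro v w q hq hend
    by_cases hex : ∃ a', a' ≠ a ∧ 0 < y a' b ∧ y a' b < 1
    · obtain ⟨a', ha', hy⟩ := hex
      exact Or.inl (key q hq ⟨Sum.inl a', by simpa using ha',
        hend _ ⟨a', b, Or.inr ⟨rfl, rfl⟩, hy⟩⟩)
    · exact Or.inr fun a' ha' hy => hex ⟨a', ha', hy⟩
  rcases h with ⟨v, q, hq, h⟩ | ⟨v, w, q, -, hq, hv, hw, h⟩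
  · refine Or.inl (key q h (hq.exists_ne_mem_edges ?_))
    rw [Sym2.eq_swap]
    exact (h.2.2.2 a b).mp hab
  · -- at the two ends of the path maximality applies, at inner vertices the path has two edges
    by_cases hbv : Sum.inr b = v
    · subst hbv
      exact key' q h hv
    by_cases hbw : Sum.inr b = w
    · subst hbw
      exact key' q h hw
    refine Or.inl (key q h (hq.exists_ne_mem_edges hbv hbw ?_))
    rw [Sym2.eq_swap]
    exact (h.2.2.2 a b).mp hab

/-- At a vertex on the right whose values add up to `1` a second edge of the cycle or path always
exists: a single floating edge cannot complete integral values to the sum `1`. -/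
theorem exists_ne_of_sum_eq_one [Fintype A] (h : IsAlternatingPair y M₁ M₂)
    (hy : ∀ a b, 0 ≤ y a b ∧ y a b ≤ 1) {a : A} {b : B} (hsum : ∑ a, y a b = 1)
    (hab : (a, b) ∈ M₁ ∨ (a, b) ∈ M₂) :
    ∃ a', a' ≠ a ∧ ((a', b) ∈ M₁ ∨ (a', b) ∈ M₂) := by
  classical
  refine (h.exists_ne_or_unique hab).resolve_right fun huniq => ?_
  have hf := h.floating hab
  rw [← Finset.add_sum_erase _ _ (Finset.mem_univ a)] at hsum
  have hint : ∀ a', a' ≠ a → y a' b = 0 ∨ y a' b = 1 := by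
    intro a' ha'
    have h1 := huniq a' ha'
    have h2 := hy a' b
    by_contra! hne
    exact h1 ⟨lt_of_le_of_ne h2.1 hne.1.symm, lt_of_le_of_ne h2.2 hne.2⟩
  by_cases hone : ∃ a', a' ≠ a ∧ y a' b = 1
  · obtain ⟨a', ha', h1⟩ := hone
    have := Finset.single_le_sum (f := fun a => y a b) (fun i _ => (hy i b).1)
      (Finset.mem_erase.mpr ⟨ha', Finset.mem_univ a'⟩)
    linarith
  · push Not at hone
    rw [Finset.sum_eq_zero fun a' ha' =>
      (hint a' (Finset.ne_of_mem_erase ha')).resolve_right (hone a' (Finset.ne_of_mem_erase ha'))]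
      at hsum
    linarith

end IsAlternatingPair

/-- Some cycle or maximal path of floating edges exists as long as some edge is floating. -/
theorem exists_isAlternatingPair [Finite A] [Finite B] {y : A → B → ℝ} {a : A} {b : B}
    (h : 0 < y a b ∧ y a b < 1) :
    ∃ M₁ M₂, IsAlternatingPair y M₁ M₂ ∧ ∃ a b, (a, b) ∈ M₁ ∨ (a, b) ∈ M₂ := by
  have hadj : (floatingGraph y).Adj (Sum.inl a) (Sum.inr b) := ⟨a, b, Or.inl ⟨rfl, rfl⟩, h⟩
  have key : ∀ {v w : A ⊕ B} (q : (floatingGraph y).Walk v w) {M₁ M₂ : Finset (A × B)},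
      ¬ q.Nil → IsMatchingPartition q M₁ M₂ → ∃ a b, (a, b) ∈ M₁ ∨ (a, b) ∈ M₂ := by
    intro v w q M₁ M₂ hn hq
    have he := q.mk_start_snd_mem_edges hn
    obtain ⟨a, b, h, -⟩ := q.adj_of_mem_edges he
    refine ⟨a, b, (hq.2.2.2 a b).mpr ?_⟩
    rcases h with ⟨h1, h2⟩ | ⟨h1, h2⟩
    · rwa [← h1, ← h2]
    · rwa [← h1, ← h2, Sym2.eq_swap]
  rcases (floatingGraph y).exists_isCycle_or_maximal_isPath hadj with
    ⟨v, q, hq⟩ | ⟨v, w, q, hne, hq, hv, hw⟩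
  · obtain ⟨M₁, M₂, hM⟩ := exists_isMatchingPartition q hq.isTrail hq.nodup_dropLast_support
      hq.support_nodup
    exact ⟨M₁, M₂, Or.inl ⟨v, q, hq, hM⟩, key q hq.not_nil hM⟩
  · obtain ⟨M₁, M₂, hM⟩ := exists_isMatchingPartition q hq.isTrail
      (hq.support_nodup.sublist (List.dropLast_sublist _))
      (hq.support_nodup.sublist (List.tail_sublist _))
    exact ⟨M₁, M₂, Or.inr ⟨v, w, q, hne, hq, hv, hw, hM⟩,
      key q (SimpleGraph.Walk.not_nil_of_ne hne) hM⟩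

/-- `γ` is the least positive amount that makes some edge integral when `M₁` is raised and `M₂`
lowered. -/
def IsStepSize (y : A → B → ℝ) (M₁ M₂ : Finset (A × B)) (γ : ℝ) : Prop :=
  IsLeast {γ : ℝ | 0 < γ ∧
    ((∃ e ∈ M₁, y e.1 e.2 + γ = 1) ∨ (∃ e ∈ M₂, y e.1 e.2 - γ = 0))} γ

section StepSize

variable {y : A → B → ℝ} {M₁ M₂ : Finset (A × B)} {γ : ℝ}

/-- The amount by which `M₁` can be lowered and `M₂` raised is the step size of the exchanged
matchings. -/
theorem isStepSize_swap_iff : IsStepSize y M₂ M₁ γ ↔ IsLeast {γ : ℝ | 0 < γ ∧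
    ((∃ e ∈ M₁, y e.1 e.2 - γ = 0) ∨ (∃ e ∈ M₂, y e.1 e.2 + γ = 1))} γ := by
  simp only [IsStepSize, or_comm]

theorem IsAlternatingPair.exists_isStepSize (h : IsAlternatingPair y M₁ M₂)
    (hne : ∃ a b, (a, b) ∈ M₁ ∨ (a, b) ∈ M₂) : ∃ γ, IsStepSize y M₁ M₂ γ := by
  set s := {γ : ℝ | 0 < γ ∧
    ((∃ e ∈ M₁, y e.1 e.2 + γ = 1) ∨ (∃ e ∈ M₂, y e.1 e.2 - γ = 0))} with hs
  have hfin : s.Finite := by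
    refine ((M₁.finite_toSet.image fun e => 1 - y e.1 e.2).union
      (M₂.finite_toSet.image fun e => y e.1 e.2)).subset ?_
    rintro γ ⟨-, ⟨e, he, heq⟩ | ⟨e, he, heq⟩⟩
    · exact Or.inl ⟨e, he, by simp only; linarith⟩
    · exact Or.inr ⟨e, he, by simp only; linarith⟩
  have hsne : s.Nonempty := by
    obtain ⟨a, b, hab⟩ := hne
    have hf := h.floating hab
    rcases hab with hab | hab
    · exact ⟨1 - y a b, by linarith, Or.inl ⟨_, hab, by simp⟩⟩
    · exact ⟨y a b, hf.1, Or.inr ⟨_, hab, by simp⟩⟩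
  obtain ⟨γ, hγ, hmin⟩ := Set.exists_min_image s id hfin hsne
  exact ⟨γ, hγ, hmin⟩

variable [DecidableEq A] [DecidableEq B]

theorem shiftEdges_neg (h : Disjoint M₁ M₂) :
    shiftEdges y M₁ M₂ (-γ) = shiftEdges y M₂ M₁ γ := by
  funext a b
  have := fun h₁ : (a, b) ∈ M₁ => Finset.disjoint_left.mp h h₁
  by_cases h₁ : (a, b) ∈ M₁ <;> by_cases h₂ : (a, b) ∈ M₂ <;>
    simp_all [shiftEdges, sub_eq_add_neg]

theorem shiftEdges_apply (h : Disjoint M₁ M₂) (a : A) (b : B) :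
    shiftEdges y M₁ M₂ γ a b =
      y a b + γ * ((if (a, b) ∈ M₁ then 1 else 0) - (if (a, b) ∈ M₂ then 1 else 0)) := by
  have := fun h₁ : (a, b) ∈ M₁ => Finset.disjoint_left.mp h h₁
  by_cases h₁ : (a, b) ∈ M₁ <;> by_cases h₂ : (a, b) ∈ M₂ <;>
    simp_all [shiftEdges, sub_eq_add_neg]

theorem IsStepSize.mem_Icc_shiftEdges (hγ : IsStepSize y M₁ M₂ γ)
    (h : IsAlternatingPair y M₁ M₂) (hy : ∀ a b, 0 ≤ y a b ∧ y a b ≤ 1) (a : A) (b : B) :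
    0 ≤ shiftEdges y M₁ M₂ γ a b ∧ shiftEdges y M₁ M₂ γ a b ≤ 1 := by
  have hpos : 0 < γ := hγ.1.1
  unfold shiftEdges
  split_ifs with h₁ h₂
  · have hf := h.floating (Or.inl h₁)
    have : γ ≤ 1 - y a b := hγ.2 ⟨by linarith, Or.inl ⟨_, h₁, by simp⟩⟩
    constructor <;> linarith
  · have hf := h.floating (Or.inr h₂)
    have : γ ≤ y a b := hγ.2 ⟨hf.1, Or.inr ⟨_, h₂, by simp⟩⟩
    constructor <;> linarith
  · exact hy a b

theorem IsAlternatingPair.shiftEdges_eq_self (h : IsAlternatingPair y M₁ M₂) {a : A} {b : B}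
    (hab : ¬ (0 < y a b ∧ y a b < 1)) : shiftEdges y M₁ M₂ γ a b = y a b := by
  unfold shiftEdges
  rw [if_neg fun h₁ => hab (h.floating (Or.inl h₁)), if_neg fun h₂ => hab (h.floating (Or.inr h₂))]

/-- A step makes at least one floating edge integral and no integral edge floating. -/
theorem IsStepSize.card_floating_lt [Fintype A] [Fintype B] (hγ : IsStepSize y M₁ M₂ γ)
    (h : IsAlternatingPair y M₁ M₂) :
    (Finset.univ.filter fun e : A × B => 0 < shiftEdges y M₁ M₂ γ e.1 e.2 ∧
      shiftEdges y M₁ M₂ γ e.1 e.2 < 1).card <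
    (Finset.univ.filter fun e : A × B => 0 < y e.1 e.2 ∧ y e.1 e.2 < 1).card := by
  refine Finset.card_lt_card (Finset.ssubset_iff_of_subset ?_ |>.mpr ?_)
  · intro e
    simp only [Finset.mem_filter, Finset.mem_univ, true_and]
    intro he
    by_contra hne
    rw [h.shiftEdges_eq_self hne] at he
    exact hne he
  · simp only [Finset.mem_filter, Finset.mem_univ, true_and]
    rcases hγ.1.2 with ⟨⟨a, b⟩, he, heq⟩ | ⟨⟨a, b⟩, he, heq⟩
    · refine ⟨(a, b), h.floating (Or.inl he), ?_⟩
      simp only at heq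
      simp [shiftEdges, he, heq]
    · refine ⟨(a, b), h.floating (Or.inr he), ?_⟩
      simp only at heq
      simp [shiftEdges, he, heq, Finset.disjoint_right.mp h.disjoint he]

/-- Steps preserve the sum `1` of the values at a vertex on the right: there the cycle or path has
exactly one edge in each of the two matchings, or none at all. -/
theorem IsAlternatingPair.sum_shiftEdges [Fintype A] (h : IsAlternatingPair y M₁ M₂)
    (hy : ∀ a b, 0 ≤ y a b ∧ y a b ≤ 1) {b : B} (hsum : ∑ a, y a b = 1) :
    ∑ a, shiftEdges y M₁ M₂ γ a b = 1 := by
  simp only [shiftEdges_apply h.disjoint, Finset.sum_add_distrib, ← Finset.mul_sum,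
    Finset.sum_sub_distrib, hsum]
  have key : ∀ {M₁ M₂ : Finset (A × B)}, IsAlternatingPair y M₁ M₂ → ∀ a, (a, b) ∈ M₁ →
      ∑ a, (if (a, b) ∈ M₁ then (1 : ℝ) else 0) = 1 ∧ ∃ a', (a', b) ∈ M₂ := by
    intro M₁ M₂ h a ha
    have huniq : ∀ a', (a', b) ∈ M₁ → a' = a := fun a' ha' =>
      congrArg Prod.fst (h.isEdgeMatching _ ha' _ ha (Or.inr rfl))
    refine ⟨?_, ?_⟩
    · rw [Finset.sum_eq_single a (fun a' _ hne => if_neg fun ha' => hne (huniq a' ha'))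
        (by simp), if_pos ha]
    · obtain ⟨a', hne, ha' | ha'⟩ := h.exists_ne_of_sum_eq_one hy hsum (Or.inl ha)
      · exact absurd (huniq a' ha') hne
      · exact ⟨a', ha'⟩
  by_cases h₁ : ∃ a, (a, b) ∈ M₁
  · obtain ⟨a, ha⟩ := h₁
    obtain ⟨hs, a', ha'⟩ := key h a ha
    rw [hs, (key h.symm a' ha').1]
    ring
  · by_cases h₂ : ∃ a, (a, b) ∈ M₂
    · obtain ⟨a, ha⟩ := h₂
      exact absurd (key h.symm a ha).2 h₁
    · push Not at h₁ h₂
      simp [h₁, h₂]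

end StepSize

end Rounding

/-! ### Laws of dependent rounding -/

section Rounding

variable {A B : Type*} [DecidableEq A] [DecidableEq B]

/-- Dependent rounding can be carried out: each step reduces the number of floating edges. -/
theorem exists_dependentRounding [Fintype A] [Fintype B] (y : A → B → ℝ)
    (hy : ∀ a b, 0 ≤ y a b ∧ y a b ≤ 1) : ∃ ν, DependentRounding y ν := by
  induction hn : (Finset.univ.filter fun e : A × B => 0 < y e.1 e.2 ∧ y e.1 e.2 < 1).card
    using Nat.strong_induction_on generalizing y with
  | _ n ih =>
    by_cases hfl : ∃ a b, 0 < y a b ∧ y a b < 1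
    · obtain ⟨a, b, hab⟩ := hfl
      obtain ⟨M₁, M₂, hM, hne⟩ := exists_isAlternatingPair hab
      obtain ⟨α, hα⟩ := hM.exists_isStepSize hne
      obtain ⟨β, hβ⟩ := hM.symm.exists_isStepSize (by simpa only [or_comm] using hne)
      obtain ⟨ν₁, h₁⟩ := ih _ (hn ▸ hα.card_floating_lt hM) _ (hα.mem_Icc_shiftEdges hM hy) rfl
      obtain ⟨ν₂, h₂⟩ := ih _ (hn ▸ hβ.card_floating_lt hM.symm) _
        (hβ.mem_Icc_shiftEdges hM.symm hy) rfl
      rw [← shiftEdges_neg hM.disjoint] at h₂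
      exact ⟨_, .step y M₁ M₂ α β ν₁ ν₂ hM hα (isStepSize_swap_iff.mp hβ) h₁ h₂⟩
    · refine ⟨_, .done y fun a b => ?_⟩
      by_contra! hne
      exact hfl ⟨a, b, lt_of_le_of_ne (hy a b).1 hne.1.symm, lt_of_le_of_ne (hy a b).2 hne.2⟩

namespace DependentRounding

variable {y : A → B → ℝ} {ν : Measure (A → B → ℝ)}

theorem isProbabilityMeasure (h : DependentRounding y ν) : IsProbabilityMeasure ν := by
  induction h with
  | done y hy => infer_instance
  | step y M₁ M₂ α β ν₁ ν₂ hM hα hβ h₁ h₂ ih₁ ih₂ =>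
    have hα0 : 0 < α := hα.1.1
    have hβ0 : 0 < β := hβ.1.1
    constructor
    simp only [Measure.add_apply, Measure.smul_apply, measure_univ, smul_eq_mul, mul_one]
    rw [← ENNReal.ofReal_add (by positivity) (by positivity), ← add_div, add_comm β α,
      div_self (by positivity), ENNReal.ofReal_one]

/-- The output is integral, and it has every property of the input that the steps preserve. -/
theorem ae_of_invariant [Countable A] [Countable B] (h : DependentRounding y ν)
    {Inv : (A → B → ℝ) → Prop}
    (hInv : ∀ (y : A → B → ℝ) (M₁ M₂ : Finset (A × B)) (γ : ℝ), IsAlternatingPair y M₁ M₂ →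
      IsStepSize y M₁ M₂ γ → Inv y → Inv (shiftEdges y M₁ M₂ γ))
    (hy : Inv y) : ∀ᵐ X ∂ν, Inv X ∧ ∀ a b, X a b = 0 ∨ X a b = 1 := by
  induction h with
  | done y hint =>
    rw [ae_dirac_eq]
    exact ⟨hy, hint⟩
  | step y M₁ M₂ α β ν₁ ν₂ hM hα hβ h₁ h₂ ih₁ ih₂ =>
    rw [ae_add_measure_iff]
    refine ⟨Measure.ae_smul_measure (ih₁ (hInv y M₁ M₂ α hM hα hy)) _,
      Measure.ae_smul_measure (ih₂ ?_) _⟩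
    rw [shiftEdges_neg hM.disjoint]
    exact hInv y M₂ M₁ β hM.symm (isStepSize_swap_iff.mpr hβ) hy

/-- If the values at every vertex on the right add up to `1`, the output is almost surely the
indicator of a map into the left side, along edges of the input. -/
theorem ae_exists_assignment [Fintype A] [Countable B] (h : DependentRounding y ν)
    (hy : ∀ a b, 0 ≤ y a b ∧ y a b ≤ 1) (hsum : ∀ b, ∑ a, y a b = 1) :
    ∀ᵐ X ∂ν, ∃ φ : B → A, (∀ a b, X a b = if φ b = a then 1 else 0) ∧ ∀ b, y (φ b) b ≠ 0 := by
  have key := h.ae_of_invariant (Inv := fun z => (∀ a b, 0 ≤ z a b ∧ z a b ≤ 1) ∧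
    (∀ b, ∑ a, z a b = 1) ∧ ∀ a b, y a b = 0 → z a b = 0) ?_ ⟨hy, hsum, fun _ _ => id⟩
  · filter_upwards [key] with X ⟨⟨_, hX, hX0⟩, hint⟩
    have hex : ∀ b, ∃ a, X a b = 1 := by
      intro b
      by_contra! hne
      have := hX b
      rw [Finset.sum_eq_zero fun a _ => (hint a b).resolve_right (hne a)] at this
      exact zero_ne_one this
    choose φ hφ using hex
    refine ⟨φ, fun a b => ?_, fun b hb => by simpa [hφ] using hX0 _ _ hb⟩
    split_ifs with hab
    · rw [← hab, hφ]
    · refine (hint a b).resolve_right fun h1 => ?_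
      have hle := Finset.add_le_sum (f := fun a => X a b) (s := Finset.univ)
        (fun i _ => by rcases hint i b with h | h <;> simp [h])
        (Finset.mem_univ (φ b)) (Finset.mem_univ a) hab
      rw [hX b, hφ, h1] at hle
      norm_num at hle
  · rintro z M₁ M₂ γ hM hγ ⟨hz, hzsum, hz0⟩
    refine ⟨hγ.mem_Icc_shiftEdges hM hz, fun b => hM.sum_shiftEdges hz (hzsum b), ?_⟩
    intro a b hab
    rw [hM.shiftEdges_eq_self (by simp [hz0 a b hab]), hz0 a b hab]

end DependentRounding

/-! ### Concentration at a vertex -/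

/-- At a vertex `a`, a step raises at most one edge and lowers at most one. If all `t b` have the
same sign, `∏ b, (1 + t b * y a b)` is therefore a concave function of the shift, and lies below
its tangent at `0`. -/
theorem exists_prod_shiftEdges_le [Fintype B] {y : A → B → ℝ} {M₁ M₂ : Finset (A × B)}
    (hM : IsAlternatingPair y M₁ M₂) (a : A) {t : B → ℝ}
    (hsign : ∀ b b', 0 ≤ t b * t b') (hnn : ∀ b, 0 ≤ 1 + t b * y a b) :
    ∃ K, ∀ γ, ∏ b, (1 + t b * shiftEdges y M₁ M₂ γ a b) ≤
      ∏ b, (1 + t b * y a b) + γ * K := by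
  have huniq₁ : ∀ b b', (a, b) ∈ M₁ → (a, b') ∈ M₁ → b = b' := fun b b' h h' =>
    congrArg Prod.snd (hM.isEdgeMatching _ h _ h' (Or.inl rfl))
  have huniq₂ : ∀ b b', (a, b) ∈ M₂ → (a, b') ∈ M₂ → b = b' := fun b b' h h' =>
    congrArg Prod.snd (hM.symm.isEdgeMatching _ h _ h' (Or.inl rfl))
  -- a single affected edge makes the product affine in the shift
  have single : ∀ (b₀ : B) (σ : ℝ),
      (∀ γ b, shiftEdges y M₁ M₂ γ a b = if b = b₀ then y a b + γ * σ else y a b) →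
      ∃ K, ∀ γ, ∏ b, (1 + t b * shiftEdges y M₁ M₂ γ a b) ≤
        ∏ b, (1 + t b * y a b) + γ * K := by
    intro b₀ σ hs
    refine ⟨t b₀ * σ * ∏ b ∈ Finset.univ.erase b₀, (1 + t b * y a b), fun γ => le_of_eq ?_⟩
    rw [← Finset.mul_prod_erase _ _ (Finset.mem_univ b₀),
      ← Finset.mul_prod_erase _ (fun b => 1 + t b * y a b) (Finset.mem_univ b₀),
      Finset.prod_congr rfl fun b hb => by
        rw [hs, if_neg (Finset.ne_of_mem_erase hb)]]
    rw [hs, if_pos rfl]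
    ring
  by_cases h₁ : ∃ b, (a, b) ∈ M₁ <;> by_cases h₂ : ∃ b, (a, b) ∈ M₂
  · obtain ⟨b₁, hb₁⟩ := h₁
    obtain ⟨b₂, hb₂⟩ := h₂
    have hne : b₂ ≠ b₁ := by
      rintro rfl
      exact Finset.disjoint_left.mp hM.disjoint hb₁ hb₂
    set R := ∏ b ∈ (Finset.univ.erase b₁).erase b₂, (1 + t b * y a b) with hR
    have hR0 : 0 ≤ R := Finset.prod_nonneg fun b _ => hnn b
    refine ⟨(t b₁ * (1 + t b₂ * y a b₂) - t b₂ * (1 + t b₁ * y a b₁)) * R, fun γ => ?_⟩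
    have hmem : b₂ ∈ Finset.univ.erase b₁ := Finset.mem_erase.mpr ⟨hne, Finset.mem_univ _⟩
    rw [← Finset.mul_prod_erase _ _ (Finset.mem_univ b₁), ← Finset.mul_prod_erase _ _ hmem,
      ← Finset.mul_prod_erase _ (fun b => 1 + t b * y a b) (Finset.mem_univ b₁),
      ← Finset.mul_prod_erase _ (fun b => 1 + t b * y a b) hmem,
      Finset.prod_congr rfl fun b hb => by
        have hb2 := Finset.ne_of_mem_erase hb
        have hb1 := Finset.ne_of_mem_erase (Finset.mem_of_mem_erase hb)
        rw [shiftEdges, if_neg fun h => hb1 (huniq₁ _ _ h hb₁),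
          if_neg fun h => hb2 (huniq₂ _ _ h hb₂)], ← hR]
    have e₁ : shiftEdges y M₁ M₂ γ a b₁ = y a b₁ + γ := by simp [shiftEdges, hb₁]
    have e₂ : shiftEdges y M₁ M₂ γ a b₂ = y a b₂ - γ := by
      simp [shiftEdges, hb₂, Finset.disjoint_right.mp hM.disjoint hb₂]
    rw [e₁, e₂]
    -- the quadratic term `-t b₁ * t b₂ * γ²` is nonpositive
    have := mul_nonneg (mul_nonneg (hsign b₁ b₂) (sq_nonneg γ)) hR0
    linear_combination this
  · obtain ⟨b₁, hb₁⟩ := h₁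
    push Not at h₂
    refine single b₁ 1 fun γ b => ?_
    by_cases hb : b = b₁
    · simp [shiftEdges, hb, hb₁]
    · have hbM : (a, b) ∉ M₁ := fun h => hb (huniq₁ _ _ h hb₁)
      simp [shiftEdges, hb, hbM, h₂]
  · obtain ⟨b₂, hb₂⟩ := h₂
    push Not at h₁
    refine single b₂ (-1) fun γ b => ?_
    by_cases hb : b = b₂
    · simp [shiftEdges, hb, hb₂, h₁, sub_eq_add_neg]
    · have hbM : (a, b) ∉ M₂ := fun h => hb (huniq₂ _ _ h hb₂)
      simp [shiftEdges, hb, hbM, h₁]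
  · push Not at h₁ h₂
    exact ⟨0, fun γ => by simp [shiftEdges, h₁, h₂]⟩

namespace DependentRounding

variable {y : A → B → ℝ} {ν : Measure (A → B → ℝ)}

/-- Markov's inequality for the supermartingale `∏ b, (1 + t b * y a b)`. -/
theorem measureReal_mul_le [Countable A] [Fintype B] (h : DependentRounding y ν)
    (hy : ∀ a b, 0 ≤ y a b ∧ y a b ≤ 1) (a : A) {t : B → ℝ} (ht : ∀ b, -1 ≤ t b)
    (hsign : ∀ b b', 0 ≤ t b * t b') {E : Set (A → B → ℝ)} {C : ℝ}
    (hE : ∀ X ∈ E, (∀ b, X a b = 0 ∨ X a b = 1) → C ≤ ∏ b, (1 + t b * X a b)) :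
    ν.real E * C ≤ ∏ b, (1 + t b * y a b) := by
  have hnn : ∀ y : A → B → ℝ, (∀ a b, 0 ≤ y a b ∧ y a b ≤ 1) → ∀ b, 0 ≤ 1 + t b * y a b := by
    intro y hy b
    nlinarith [hy a b, ht b]
  induction h with
  | done y hint =>
    by_cases hyE : y ∈ E
    · simpa [measureReal_def, Measure.dirac_apply, hyE] using hE y hyE (hint a)
    · simpa [measureReal_def, Measure.dirac_apply, hyE] using
        Finset.prod_nonneg fun b _ => hnn y hy b
  | step y M₁ M₂ α β ν₁ ν₂ hM hα hβ h₁ h₂ ih₁ ih₂ =>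
    have hα0 : 0 < α := hα.1.1
    have hβ0 : 0 < β := hβ.1.1
    have := h₁.isProbabilityMeasure
    have := h₂.isProbabilityMeasure
    obtain ⟨K, hK⟩ := exists_prod_shiftEdges_le hM a hsign (hnn y hy)
    have i₁ := (ih₁ (IsStepSize.mem_Icc_shiftEdges hα hM hy)).trans (hK α)
    have i₂ := (ih₂ (by
      rw [shiftEdges_neg hM.disjoint]
      exact (isStepSize_swap_iff.mpr hβ).mem_Icc_shiftEdges hM.symm hy)).trans (hK (-β))
    have hE' : (ENNReal.ofReal (β / (α + β)) • ν₁ + ENNReal.ofReal (α / (α + β)) • ν₂).real E =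
        (β * ν₁.real E + α * ν₂.real E) / (α + β) := by
      rw [measureReal_def, Measure.add_apply, Measure.smul_apply, Measure.smul_apply,
        smul_eq_mul, smul_eq_mul, ENNReal.toReal_add (by finiteness) (by finiteness),
        ENNReal.toReal_mul, ENNReal.toReal_mul, ENNReal.toReal_ofReal (by positivity),
        ENNReal.toReal_ofReal (by positivity), ← measureReal_def, ← measureReal_def]
      ring
    rw [hE', div_mul_eq_mul_div, div_le_iff₀ (by positivity)]
    have j₁ := mul_le_mul_of_nonneg_left i₁ hβ0.le
    have j₂ := mul_le_mul_of_nonneg_left i₂ hα0.le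
    linear_combination j₁ + j₂

/-- The Chernoff method: the exponential moments of the weighted sum of the rounded values at a
vertex obey the bound `exp (μ * (exp θ - 1))` known for independent roundings. Positive `θ` gives
the upper tail, negative `θ` the lower one. -/
theorem measureReal_le_exp [Countable A] [Fintype B] (h : DependentRounding y ν)
    (hy : ∀ a b, 0 ≤ y a b ∧ y a b ≤ 1) (a : A) {q : B → ℝ} (hq : ∀ b, 0 ≤ q b ∧ q b ≤ 1)
    (θ v : ℝ) :
    ν.real {X | v ≤ θ * ∑ b, q b * X a b} ≤
      Real.exp ((∑ b, q b * y a b) * (Real.exp θ - 1) - v) := by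
  have hmarkov := h.measureReal_mul_le hy a (t := fun b => Real.exp (θ * q b) - 1)
    (E := {X | v ≤ θ * ∑ b, q b * X a b}) (C := Real.exp v)
    (fun b => by linarith [Real.exp_pos (θ * q b)]) ?_ ?_
  · rw [Real.exp_sub, le_div_iff₀ (Real.exp_pos v)]
    refine hmarkov.trans ?_
    rw [Finset.sum_mul, Real.exp_sum]
    refine Finset.prod_le_prod (fun b _ => ?_) fun b _ => ?_
    · nlinarith [hy a b, Real.exp_pos (θ * q b)]
    · have hconv : Real.exp (θ * q b) ≤ 1 - q b + q b * Real.exp θ := by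
        have := convexOn_exp.2 (Set.mem_univ 0) (Set.mem_univ θ) (sub_nonneg.mpr (hq b).2)
          (hq b).1 (by ring)
        simpa [mul_comm] using this
      have hmul := mul_le_mul_of_nonneg_right hconv (hy a b).1
      -- `1 + u ≤ exp u`, after `exp (θ * q) - 1 ≤ q * (exp θ - 1)` by convexity
      have hexp := Real.add_one_le_exp (q b * y a b * (Real.exp θ - 1))
      linarith
  · intro b b'
    rcases le_total 0 θ with hθ | hθ
    · exact mul_nonneg (sub_nonneg.mpr (Real.one_le_exp (mul_nonneg hθ (hq b).1)))
        (sub_nonneg.mpr (Real.one_le_exp (mul_nonneg hθ (hq b').1)))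
    · exact mul_nonneg_of_nonpos_of_nonpos
        (sub_nonpos.mpr (Real.exp_le_one_iff.mpr (mul_nonpos_of_nonpos_of_nonneg hθ (hq b).1)))
        (sub_nonpos.mpr (Real.exp_le_one_iff.mpr (mul_nonpos_of_nonpos_of_nonneg hθ (hq b').1)))
  · intro X hX hint
    have heq : ∏ b, (1 + (Real.exp (θ * q b) - 1) * X a b) =
        Real.exp (θ * ∑ b, q b * X a b) := by
      rw [Finset.mul_sum, Real.exp_sum]
      refine Finset.prod_congr rfl fun b _ => ?_
      rcases hint b with h | h <;> simp [h]
    rw [heq]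
    exact Real.exp_le_exp.mpr hX

end DependentRounding

/-- The exponent of the upper tail in the multiplicative Chernoff bound. -/
theorem sub_one_add_mul_log_le {δ : ℝ} (h₀ : 0 < δ) (h₁ : δ < 1) :
    δ - (1 + δ) * Real.log (1 + δ) ≤ -(δ ^ 2 / 3) := by
  have hlog := Real.le_log_one_add_of_nonneg h₀.le
  have hmul := mul_le_mul_of_nonneg_left hlog (by linarith : 0 ≤ 1 + δ)
  have : δ + δ ^ 2 / 3 ≤ (1 + δ) * (2 * δ / (δ + 2)) := by
    rw [mul_div_assoc', le_div_iff₀ (by linarith)]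
    nlinarith [pow_pos h₀ 2, pow_pos h₀ 3]
  linarith

theorem Real.exp_neg_le_quadratic {s : ℝ} (hs : 0 ≤ s) : Real.exp (-s) ≤ 1 - s + s ^ 2 / 2 := by
  have h := Real.quadratic_le_exp_of_nonneg hs
  rw [Real.exp_neg, inv_le_comm₀ (Real.exp_pos s) (by nlinarith [sq_nonneg (s - 1)])]
  refine le_trans ?_ h
  rw [inv_le_iff_one_le_mul₀ (by nlinarith [sq_nonneg (s - 1)])]
  nlinarith [pow_nonneg hs 4]

/-- The multiplicative Chernoff bound for dependent rounding. -/
theorem DependentRounding.chernoff [Countable A] [Fintype B] {y : A → B → ℝ}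
    {ν : Measure (A → B → ℝ)} (h : DependentRounding y ν)
    (hy : ∀ a b, 0 ≤ y a b ∧ y a b ≤ 1) (a : A) {q : B → ℝ} (hq : ∀ b, 0 ≤ q b ∧ q b ≤ 1)
    {δ : ℝ} (h₀ : 0 < δ) (h₁ : δ < 1) :
    ν.real {X | δ * ∑ b, q b * y a b ≤ |∑ b, q b * X a b - ∑ b, q b * y a b|} ≤
      2 * Real.exp (-((∑ b, q b * y a b) * δ ^ 2 / 3)) := by
  have := h.isProbabilityMeasure
  set μ := ∑ b, q b * y a b with hμ
  have hμ0 : 0 ≤ μ := Finset.sum_nonneg fun b _ => mul_nonneg (hq b).1 (hy a b).1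
  -- `log (1 + δ)` is optimal for the upper tail; `-δ` is good enough for the lower one
  have hup := h.measureReal_le_exp hy a hq (Real.log (1 + δ)) (Real.log (1 + δ) * ((1 + δ) * μ))
  have hlo := h.measureReal_le_exp hy a hq (-δ) (-δ * ((1 - δ) * μ))
  rw [← hμ] at hup hlo
  have hup' : _ ≤ Real.exp (-(μ * δ ^ 2 / 3)) := hup.trans (Real.exp_le_exp.mpr (by
    rw [Real.exp_log (by linarith)]
    linear_combination μ * sub_one_add_mul_log_le h₀ h₁))
  have hlo' : _ ≤ Real.exp (-(μ * δ ^ 2 / 3)) := hlo.trans (Real.exp_le_exp.mpr (by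
    have h2 := mul_nonneg hμ0 (sq_nonneg δ)
    linear_combination μ * Real.exp_neg_le_quadratic h₀.le + h2 / 6))
  refine le_trans (measureReal_mono (s₂ := _ ∪ _) ?_)
    ((measureReal_union_le _ _).trans ((add_le_add hup' hlo').trans (two_mul _).ge))
  have hlog : 0 < Real.log (1 + δ) := Real.log_pos (by linarith)
  intro X hX
  rcases le_abs.mp (show δ * μ ≤ |∑ b, q b * X a b - μ| from hX) with hX | hX
  · have hle : (1 + δ) * μ ≤ ∑ b, q b * X a b := by linarith
    exact Or.inl (mul_le_mul_of_nonneg_left hle hlog.le)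
  · have hle : ∑ b, q b * X a b ≤ (1 - δ) * μ := by linarith
    exact Or.inr (mul_le_mul_of_nonpos_left hle (neg_nonpos.mpr h₀.le))

end Rounding

/-! ### The fair assignment LP -/

theorem dist_le_centerCost {P : Type*} [Finite P] [MetricSpace P] (φ : P → P) (j : P) :
    dist j (φ j) ≤ centerCost φ :=
  le_ciSup (f := fun j => dist j (φ j)) (Set.finite_range _).bddAbove j

theorem centerCost_nonneg {P : Type*} [MetricSpace P] (φ : P → P) : 0 ≤ centerCost φ :=
  Real.iSup_nonneg fun _ => dist_nonneg

namespace FairInstance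

variable {P H : Type*} [Fintype H]

theorem p_le_one (I : FairInstance P H) (j : P) (h : H) : I.p j h ≤ 1 :=
  (Finset.single_le_sum (fun h _ => I.p_nonneg j h) (Finset.mem_univ h)).trans (I.p_sum j).le

/-- The points whose center in `S` is moved by `φ` to `i` are those of the clusters of the centers
moved to `i`. -/
theorem sum_mul_ite_comp_eq [Fintype P] [DecidableEq P] {S : Finset P} {ψ : P → P}
    (hψ : ∀ j, ψ j ∈ S) (φ : P → P) (i : P) (f : P → ℝ) :
    ∑ j, f j * (if φ (ψ j) = i then 1 else 0) =
      ∑ s ∈ S.filter (fun s => φ s = i), ∑ j ∈ cluster ψ s, f j := by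
  simp only [mul_ite, mul_one, mul_zero]
  rw [← Finset.sum_filter, ← Finset.sum_fiberwise_of_maps_to (g := ψ)
    (t := S.filter fun s => φ s = i)]
  · refine Finset.sum_congr rfl fun s hs => Finset.sum_congr ?_ fun _ _ => rfl
    ext j
    simp only [Finset.mem_filter, Finset.mem_univ, true_and, cluster] at hs ⊢
    exact ⟨And.right, fun h => ⟨h ▸ hs.2, h⟩⟩
  · intro j hj
    simp only [Finset.mem_filter, Finset.mem_univ, true_and] at hj ⊢
    exact ⟨hψ j, hj⟩

variable [Fintype P] [MetricSpace P] {I : FairInstance P H} {L α : ℝ} {S T Sopt : Finset P}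
  {φopt : P → P} {w lmin : ℝ} {x : T → P → ℝ}

/-- Only the finitely many distances matter as radii. -/
theorem LPFeasible.exists_radius_mem
    (hx : I.LPFeasible L T w x) (hw : 0 ≤ w) :
    ∃ w' ∈ insert 0 (Set.range fun e : P × P => dist e.1 e.2), w' ≤ w ∧ I.LPFeasible L T w' x := by
  obtain ⟨w', ⟨hw', hle⟩, hmax⟩ := Set.exists_max_image
    {w' ∈ insert 0 (Set.range fun e : P × P => dist e.1 e.2) | w' ≤ w} id
    (((Set.finite_range _).insert 0).subset (Set.sep_subset _ _)) ⟨0, Set.mem_insert _ _, hw⟩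
  refine ⟨w', hw', hle, { hx with radius := fun i j hij => hx.radius i j ?_ }⟩
  by_contra! hwd
  exact (hmax _ ⟨Set.mem_insert_of_mem _ ⟨((i : P), j), rfl⟩, hwd⟩).not_gt hij

theorem LPFeasible.exists_isLPSolution
    (hx : I.LPFeasible L T w x) (hT : T ⊆ S) (hw : 0 ≤ w) :
    ∃ (T : Finset P) (w : ℝ) (x : T → P → ℝ), I.IsLPSolution L S T w x := by
  have hR : ∀ w' ∈ insert (0 : ℝ) (Set.range fun e : P × P => dist e.1 e.2), 0 ≤ w' := by
    rintro w' (rfl | ⟨e, rfl⟩)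
    exacts [le_rfl, dist_nonneg]
  obtain ⟨w₁, hw₁, -, hx₁⟩ := hx.exists_radius_mem hw
  obtain ⟨w₀, ⟨hw₀, T₀, x₀, hT₀, hx₀⟩, hmin⟩ := Set.exists_min_image
    {w' ∈ insert 0 (Set.range fun e : P × P => dist e.1 e.2) |
      ∃ (T : Finset P) (x : T → P → ℝ), T ⊆ S ∧ I.LPFeasible L T w' x} id
    (((Set.finite_range _).insert 0).subset (Set.sep_subset _ _)) ⟨w₁, hw₁, T, x, hT, hx₁⟩
  refine ⟨T₀, w₀, x₀, hT₀, hR _ hw₀, hx₀, fun T' w' x' hT' hw' hx' => ?_⟩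
  obtain ⟨w₂, hw₂, hle, hx₂⟩ := hx'.exists_radius_mem hw'
  exact (hmin w₂ ⟨hw₂, T', x', hT', hx₂⟩).trans hle

theorem LPFeasible.card_mul_le (hx : I.LPFeasible L T w x) :
    (T.card : ℝ) * L ≤ Fintype.card P := by
  calc (T.card : ℝ) * L = ∑ _i : T, L := by simp
    _ ≤ ∑ i : T, ∑ j, x i j := Finset.sum_le_sum fun i _ => hx.size i
    _ = ∑ j, ∑ i : T, x i j := Finset.sum_comm
    _ = Fintype.card P := by simp only [hx.sum_eq_one, Finset.sum_const, Finset.card_univ,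
        nsmul_eq_mul, mul_one]

/-- Every color takes at least the proportion `lmin` of a nonempty cluster, so there are at most
`1 / lmin` colors. -/
theorem LPFeasible.card_colors_mul_le_one (hx : I.LPFeasible L T w x) (hL : 0 < L)
    (hl : ∀ h, lmin ≤ I.l h) (i : T) : (Fintype.card H : ℝ) * lmin ≤ 1 := by
  have hpos : 0 < ∑ j, x i j := hL.trans_le (hx.size i)
  refine le_of_mul_le_mul_right ?_ hpos
  calc (Fintype.card H : ℝ) * lmin * ∑ j, x i j = ∑ _h : H, lmin * ∑ j, x i j := by
        simp [mul_assoc]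
    _ ≤ ∑ h, ∑ j, I.p j h * x i j := Finset.sum_le_sum fun h _ =>
        (mul_le_mul_of_nonneg_right (hl h) hpos.le).trans (hx.lower i h)
    _ = ∑ j, ∑ h, I.p j h * x i j := Finset.sum_comm
    _ = 1 * ∑ j, x i j := by simp only [← Finset.sum_mul, I.p_sum, one_mul]

variable [DecidableEq P]

/-- Merging the clusters of a feasible solution, by moving each center to the one in `S` to which
the color-blind assignment sends it, keeps the color proportions within their bounds and the
cluster sizes at least `L`, and the radius is at most `α + 1` times the cost of the solution. -/
theorem IsFeasible.exists_lpFeasible (hopt : I.IsFeasible Sopt φopt)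
    (hL : ∀ i ∈ Sopt, L ≤ ((cluster φopt i).card : ℝ)) (hS : IsColorBlindApprox I.k α S) :
    ∃ (T : Finset P) (x : T → P → ℝ), T ⊆ S ∧
      I.LPFeasible L T ((α + 1) * centerCost φopt) x := by
  obtain ⟨φ, hφ, hφmin⟩ := hS
  have hsum := sum_mul_ite_comp_eq hopt.1.2 φ
  have hcard : ∀ i, ∑ j, (if φ (φopt j) = i then (1 : ℝ) else 0) =
      ∑ s ∈ Sopt.filter (fun s => φ s = i), ((cluster φopt s).card : ℝ) := fun i => by
    simpa using hsum i fun _ => 1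
  refine ⟨Sopt.image φ, fun i j => if φ (φopt j) = i then 1 else 0, ?_, ?_⟩
  · exact Finset.image_subset_iff.mpr fun s _ => hφ.2 s
  refine ⟨fun i j => ?_, fun i j => ?_, fun j => ?_, fun i h => ?_, fun i h => ?_, fun i => ?_,
    fun i j hij => ?_⟩
  · positivity
  · split_ifs <;> norm_num
  · rw [Finset.sum_eq_single ⟨φ (φopt j), Finset.mem_image_of_mem φ (hopt.1.2 j)⟩]
    · simp
    · exact fun i _ hne => if_neg fun h => hne (Subtype.ext h.symm)
    · simp
  · rw [hsum, hcard, Finset.mul_sum]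
    exact Finset.sum_le_sum fun s hs => (hopt.2 s (Finset.mem_filter.mp hs).1 h).1
  · rw [hsum, hcard, Finset.mul_sum]
    exact Finset.sum_le_sum fun s hs => (hopt.2 s (Finset.mem_filter.mp hs).1 h).2
  · obtain ⟨s, hs, hsi⟩ := Finset.mem_image.mp i.2
    rw [hcard]
    exact (hL s hs).trans (Finset.single_le_sum (f := fun s => ((cluster φopt s).card : ℝ))
      (fun _ _ => Nat.cast_nonneg _) (Finset.mem_filter.mpr ⟨hs, hsi⟩))
  · refine if_neg fun h => hij.not_ge ?_
    rw [← h, dist_comm]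
    calc dist j (φ (φopt j)) ≤ dist j (φopt j) + dist (φopt j) (φ (φopt j)) := dist_triangle _ _ _
      _ ≤ centerCost φopt + α * centerCost φopt := add_le_add (dist_le_centerCost _ _)
          ((dist_le_centerCost _ _).trans (hφmin _ _ hopt.1))
      _ = (α + 1) * centerCost φopt := by ring

theorem LPFeasible.chernoff (hx : I.LPFeasible L T w x) {ν : Measure (T → P → ℝ)}
    (hν : DependentRounding x ν) {δ : ℝ} (hδ₀ : 0 < δ) (hδ₁ : δ < 1) (i : T) (h : H) :
    ν.real {X | δ * ∑ j, I.p j h * x i j ≤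
        |∑ j, I.p j h * X i j - ∑ j, I.p j h * x i j|} ≤
      2 * Real.exp (-((∑ j, I.p j h * x i j) * δ ^ 2 / 3)) :=
  hν.chernoff (fun i j => ⟨hx.nonneg i j, hx.le_one i j⟩) i
    (fun j => ⟨I.p_nonneg j h, I.p_le_one j h⟩) hδ₀ hδ₁

/-- The union bound over at most `n / L` centers and all colors, each of which has the amount at
least `L * lmin` at each center. -/
theorem LPFeasible.measureReal_exists_le (hx : I.LPFeasible L T w x) {ν : Measure (T → P → ℝ)}
    (hν : DependentRounding x ν) {δ : ℝ} (hδ₀ : 0 < δ) (hδ₁ : δ < 1) (hL : 0 < L)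
    (hlmin : 0 < lmin) (hl : ∀ h, lmin ≤ I.l h) :
    ν.real {X | ∃ (i : T) (h : H), δ * ∑ j, I.p j h * x i j ≤
        |∑ j, I.p j h * X i j - ∑ j, I.p j h * x i j|} ≤
      2 * ((Fintype.card P : ℝ) / L) * (Fintype.card H : ℝ) *
        Real.exp (-(δ ^ 2 / 3 * L * lmin)) := by
  have hset : {X : T → P → ℝ | ∃ (i : T) (h : H), δ * ∑ j, I.p j h * x i j ≤
        |∑ j, I.p j h * X i j - ∑ j, I.p j h * x i j|} =
      ⋃ e ∈ (Finset.univ : Finset (T × H)), {X | δ * ∑ j, I.p j e.2 * x e.1 j ≤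
        |∑ j, I.p j e.2 * X e.1 j - ∑ j, I.p j e.2 * x e.1 j|} := by
    ext X
    simp
  have hμ : ∀ e : T × H, L * lmin ≤ ∑ j, I.p j e.2 * x e.1 j := fun e => by
    refine le_trans ?_ (hx.lower e.1 e.2)
    rw [mul_comm]
    exact mul_le_mul (hl _) (hx.size _) hL.le (hlmin.le.trans (hl _))
  rw [hset]
  refine (measureReal_biUnion_finset_le _ _).trans ?_
  calc ∑ e : T × H, ν.real {X | δ * ∑ j, I.p j e.2 * x e.1 j ≤
        |∑ j, I.p j e.2 * X e.1 j - ∑ j, I.p j e.2 * x e.1 j|}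
      ≤ ∑ _e : T × H, 2 * Real.exp (-(δ ^ 2 / 3 * L * lmin)) := by
        refine Finset.sum_le_sum fun e _ => (hx.chernoff hν hδ₀ hδ₁ e.1 e.2).trans ?_
        have := mul_le_mul_of_nonneg_right (hμ e) (by positivity : 0 ≤ δ ^ 2 / 3)
        gcongr
        linarith
    _ = 2 * (T.card : ℝ) * (Fintype.card H : ℝ) * Real.exp (-(δ ^ 2 / 3 * L * lmin)) := by
        simp [Fintype.card_prod]
        ring
    _ ≤ _ := by
        gcongr
        exact (le_div_iff₀ hL).mpr hx.card_mul_le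

/-- The rounded solution assigns every point to a center within the radius of the LP. -/
theorem LPFeasible.ae_exists_isClustering
    (hx : I.LPFeasible L T w x) (hw : 0 ≤ w) (hT : T.card ≤ I.k) {ν : Measure (T → P → ℝ)}
    (hν : DependentRounding x ν) :
    ∀ᵐ X ∂ν, ∃ φ : P → P, IsClustering I.k T φ ∧
      (∀ (i : T) (j : P), X i j = if φ j = (i : P) then 1 else 0) ∧ centerCost φ ≤ w := by
  filter_upwards [hν.ae_exists_assignment (fun i j => ⟨hx.nonneg i j, hx.le_one i j⟩)
    hx.sum_eq_one] with X ⟨φ, hφ, hφx⟩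
  refine ⟨fun j => φ j, ⟨hT, fun j => (φ j).2⟩, fun i j => ?_, Real.iSup_le (fun j => ?_) hw⟩
  · rw [hφ]
    exact if_congr Subtype.ext_iff rfl rfl
  · rw [dist_comm]
    by_contra! hlt
    exact hφx j (hx.radius _ _ hlt)

end FairInstance

/-- The exponential factor `exp (-K * n ^ r)` beats every power of `n`. -/
theorem eventually_mul_exp_neg_rpow_le {r K : ℝ} (hr : 0 < r) (hK : 0 < K) {D : ℝ} (hD : 0 < D)
    (c : ℝ) : ∀ᶠ n : ℕ in Filter.atTop,
      D * (n : ℝ) * Real.exp (-K * (n : ℝ) ^ r) ≤ (n : ℝ) ^ (-c) := by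
  have h := (tendsto_rpow_mul_exp_neg_mul_atTop_nhds_zero ((1 + c) / r) K hK).comp
    ((tendsto_rpow_atTop hr).comp tendsto_natCast_atTop_atTop)
  filter_upwards [h.eventually_le_const (inv_pos.mpr hD), Filter.eventually_ge_atTop 1]
    with n hn hn1
  have hn0 : (0 : ℝ) < n := by exact_mod_cast hn1
  simp only [Function.comp_apply] at hn
  rw [← Real.rpow_mul hn0.le, mul_div_cancel₀ _ hr.ne', Real.rpow_add hn0, Real.rpow_one] at hn
  rw [Real.rpow_neg hn0.le, ← one_div, le_div_iff₀ (by positivity)]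
  calc _ = D * ((n : ℝ) * (n : ℝ) ^ c * Real.exp (-K * (n : ℝ) ^ r)) := by ring
    _ ≤ D * D⁻¹ := by gcongr
    _ = 1 := mul_inv_cancel₀ hD.ne'

theorem mainTheorem6
    (r c₀ lmin δ c : ℝ) (hr₀ : 0 < r) (hr₁ : r < 1) (hc₀ : 0 < c₀) (hlmin : 0 < lmin)
    (hδ₀ : 0 < δ) (hδ₁ : δ < 1) (hc : 0 < c) :
    ∃ N : ℕ, ∀ (P H : Type*) [Fintype P] [DecidableEq P] [MetricSpace P] [Fintype H]
      (I : FairInstance P H) (_ : ∀ h, lmin ≤ I.l h)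
      (L : ℝ) (_ : 0 ≤ L)
      -- some optimal solution has all its clusters of size at least `L`
      (Sopt : Finset P) (φopt : P → P) (_ : I.IsOptimal Sopt φopt)
      (_ : ∀ i ∈ Sopt, L ≤ ((FairInstance.cluster φopt i).card : ℝ))
      -- the centers found by the color-blind algorithm
      (α : ℝ) (_ : 1 ≤ α) (S : Finset P) (_ : IsColorBlindApprox I.k α S),
      (∃ (T : Finset P) (w : ℝ) (x : T → P → ℝ), I.IsLPSolution L S T w x) ∧
      ∀ (T : Finset P) (w : ℝ) (x : T → P → ℝ), I.IsLPSolution L S T w x →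
        (∃ ν : Measure (T → P → ℝ), DependentRounding x ν) ∧
        ∀ ν : Measure (T → P → ℝ), DependentRounding x ν →
          IsProbabilityMeasure ν ∧
          -- (1) the rounded solution is a clustering of cost at most `(α + 2) OPT`
          (∀ᵐ X ∂ν, ∃ φ : P → P, IsClustering I.k T φ ∧
            (∀ (i : T) (j : P), X i j = if φ j = (i : P) then 1 else 0) ∧
            centerCost φ ≤ (α + 2) * centerCost φopt) ∧
          -- (2) every color in every cluster is concentrated around its LP amount
          (∀ (i : T) (h : H),
            ν.real {X | δ * ∑ j, I.p j h * x i j ≤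
                |∑ j, I.p j h * X i j - ∑ j, I.p j h * x i j|} ≤
              2 * Real.exp (-((∑ j, I.p j h * x i j) * δ ^ 2 / 3))) ∧
          (0 < L →
            ν.real {X | ∃ (i : T) (h : H), δ * ∑ j, I.p j h * x i j ≤
                |∑ j, I.p j h * X i j - ∑ j, I.p j h * x i j|} ≤
              2 * ((Fintype.card P : ℝ) / L) * (Fintype.card H : ℝ) *
                Real.exp (-(δ ^ 2 / 3 * L * lmin))) ∧
          (c₀ * (Fintype.card P : ℝ) ^ r ≤ L → N ≤ Fintype.card P →
            ν.real {X | ∃ (i : T) (h : H), δ * ∑ j, I.p j h * x i j ≤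
                |∑ j, I.p j h * X i j - ∑ j, I.p j h * x i j|} ≤
              (Fintype.card P : ℝ) ^ (-c)) := by

  obtain ⟨N, hN⟩ := Filter.eventually_atTop.mp (eventually_mul_exp_neg_rpow_le hr₀
    (K := δ ^ 2 / 3 * c₀ * lmin) (by positivity) (D := 2 / c₀ * (1 / lmin)) (by positivity) c)
  -- `n ≥ 1` makes `c₀ ≤ L`
  refine ⟨max N 1, ?_⟩
  intro P H _ _ _ _ I hl L hL Sopt φopt hopt hLopt α hα S hS
  obtain ⟨T₀, x₀, hT₀, hx₀⟩ := hopt.1.exists_lpFeasible hLopt hS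
  have hcost := centerCost_nonneg φopt
  have hw₀ : 0 ≤ (α + 1) * centerCost φopt := mul_nonneg (by linarith) hcost
  refine ⟨hx₀.exists_isLPSolution hT₀ hw₀, ?_⟩
  rintro T w x ⟨hTS, hw, hx, hmin⟩
  have hx01 : ∀ i j, 0 ≤ x i j ∧ x i j ≤ 1 := fun i j => ⟨hx.nonneg i j, hx.le_one i j⟩
  refine ⟨exists_dependentRounding x hx01, fun ν hν => ⟨hν.isProbabilityMeasure, ?_,
    hx.chernoff hν hδ₀ hδ₁, fun hL0 => hx.measureReal_exists_le hν hδ₀ hδ₁ hL0 hlmin hl,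
    fun hLn hn => ?_⟩⟩
  · obtain ⟨φ, hφ, -⟩ := hS
    filter_upwards [hx.ae_exists_isClustering hw ((Finset.card_le_card hTS).trans hφ.1) hν]
      with X ⟨ψ, hψ, hXψ, hψw⟩
    refine ⟨ψ, hψ, hXψ, ?_⟩
    linarith [hmin T₀ _ x₀ hT₀ hw₀ hx₀]
  · have hn1 : (1 : ℝ) ≤ Fintype.card P := by exact_mod_cast (le_max_right N 1).trans hn
    have hnr : 1 ≤ (Fintype.card P : ℝ) ^ r := Real.one_le_rpow hn1 hr₀.le
    have hcL : c₀ ≤ L := (le_mul_of_one_le_right hc₀.le hnr).trans hLn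
    have hL0 : 0 < L := hc₀.trans_le hcL
    -- the bound on the number of colors needs a nonempty cluster
    rcases isEmpty_or_nonempty T with hT | ⟨⟨i⟩⟩
    · simp only [IsEmpty.exists_iff, Set.ofPred_false, measureReal_empty]
      positivity
    refine (hx.measureReal_exists_le hν hδ₀ hδ₁ hL0 hlmin hl).trans
      (le_trans ?_ (hN _ ((le_max_left N 1).trans hn)))
    have hH : (Fintype.card H : ℝ) ≤ 1 / lmin :=
      (le_div_iff₀ hlmin).mpr (hx.card_colors_mul_le_one hL0 hl i)
    calc 2 * ((Fintype.card P : ℝ) / L) * (Fintype.card H : ℝ) *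
          Real.exp (-(δ ^ 2 / 3 * L * lmin))
        ≤ 2 * ((Fintype.card P : ℝ) / c₀) * (1 / lmin) *
          Real.exp (-(δ ^ 2 / 3 * (c₀ * (Fintype.card P : ℝ) ^ r) * lmin)) := by gcongr
      _ = _ := by
        rw [show -(δ ^ 2 / 3 * (c₀ * (Fintype.card P : ℝ) ^ r) * lmin) =
          -(δ ^ 2 / 3 * c₀ * lmin) * (Fintype.card P : ℝ) ^ r by ring]
        ring
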